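/- Let $k$ be an algebraically closed field of any characteristic, $\mathcal P=k[X_0,\dots,X_n]$ with the variables ordered by $X_0<X_1<\dots<X_n$, and let $J\subseteq\mathcal P$ be a strongly stable monomial ideal: whenever $X_iX^\delta\in J$ and $i<j$, also $X_jX^\delta\in J$. Let $B_J$ be the minimal monomial basis of $J$, $\mathcal N(J)$ the set of monomials not in $J$, and $J_m$ the degree $m$ component of $J$. For every $X^\alpha\in B_J$ and every $X^\gamma\in\mathcal N(J)$ of the same degree let $C_{\alpha\gamma}$ be a new variable; let $C$ be the set of these variables, $N$ their number, and put $$F_\alpha=X^\alpha-\sum_\gamma C_{\alpha\gamma}X^\gamma\in k[C][X_0,\dots,X_n],\qquad \mathcal G=\{F_\alpha : X^\alpha\in B_J\}.$$ For $c\in k^N$ write $f_{\alpha,c}\in\mathcal P$ for the specialization of $F_\alpha$ at $C=c$. For $m\ge 0$ let $A_m$ be the matrix over $k[C]$ whose columns are indexed by the monomials of degree $m$ in $X$ and whose rows contain the coefficients of the polynomials $X^\beta F_\alpha$ with $|\beta+\alpha|=m$. Let $\mathfrak A\subseteq k[C]$ be the ideal generated by the minors of order $\dim_k J_m+1$ of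 $A_m$, for all $m\ge 0$, and let $B\mathcal St(J)=\operatorname{Spec} k[C]/\mathfrak A\subseteq\mathbb A^N$. The head of $X^\delta F_\alpha$ is $X^{\delta+\alpha}$. Among the products with the same head, set $X^{\delta'}F_{\alpha'}<X^\delta F_\alpha$ if the first non-zero entry of $\delta'-\delta$ is positive (the entries being indexed by $0,\dots,n$ in this order), and call a product minimal if it is the minimum of the set of all products with its head. A step of $\mathcal G^{**}$-reduction of a polynomial $h\in k[C][X]$ replaces $h$ by $h-aX^\delta F_\alpha$, where $X^\delta F_\alpha$ is minimal and $a\neq 0$ is the coefficient in $h$ of its head $X^{\delta+\alpha}$. A complete $\mathcal G^{**}$-reduction of $h$ is the result $h_0$ of a finite sequence of such steps in which no monomial of $h_0$ is a multiple of an element of $B_J$. The $S$-polynomial is $S(F_\alpha,F_{\alpha'})=X^\delta F_\alpha-X^{\delta'}F_{\alpha'}$ with $X^{\delta+\alpha}=X^{\delta'+\alpha'}=\operatorname{lcm}(X^\alpha,X^{\alpha'})$. Then: 1. There is a bijection between the closed points of $B\mathcal St(J)$ and the homogeneous ideals $I\subseteq\mathcal P$ such that $\mathcal N(J)$ is a basis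 of the $k$-vector space $\mathcal P/I$. It sends the closed point with coordinates $c\in k^N$ to the ideal $(f_{\alpha,c} : X^\alpha\in B_J)$. The origin is a closed point of $B\mathcal St(J)$ and corresponds to $J$. 2. $\mathfrak A$ is homogeneous for the grading $\lambda$ of $k[C]$ over $\mathbb Z^{n+1}$ given by $\lambda(C_{\alpha\gamma})=\alpha-\gamma$. 3. Every $S(F_\alpha,F_{\alpha'})$ has a complete $\mathcal G^{**}$-reduction. For any choice of complete $\mathcal G^{**}$-reductions $H_{\alpha,\alpha'}$ of all the $S(F_\alpha,F_{\alpha'})$, let $\mathfrak R\subseteq k[C]$ be the ideal generated by the coefficients (with respect to $X$) of all the $H_{\alpha,\alpha'}$, and $\mathfrak R'$ the ideal generated by the coefficients of those $H_{\alpha,\alpha'}$ for which, in $S(F_\alpha,F_{\alpha'})=X^\delta F_\alpha-X^{\delta'}F_{\alpha'}$, the product $X^\delta F_\alpha$ is minimal. Then $\mathfrak A=\mathfrak R=\mathfrak R'$. -/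

import Mathlib

open MvPolynomial AlgebraicGeometry

noncomputable section

namespace Stratum

universe u

/-- Exponents of monomials in the variables `X_0 < X_1 < ... < X_n`. -/
abbrev Mon (n : ℕ) : Type := Fin (n + 1) →₀ ℕ

/-- The polynomial ring in `X_0, ..., X_n` over `R`. -/
abbrev Poly (n : ℕ) (R : Type u) [CommRing R] : Type u := MvPolynomial (Fin (n + 1)) R

/-- An elementary up move: a variable `X_i` dividing `X^α` is replaced by a larger one `X_j`. -/
def UpMove {n : ℕ} (α β : Mon n) : Prop :=
  ∃ (δ : Mon n) (i j : Fin (n + 1)), i < j ∧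
    α = δ + Finsupp.single i 1 ∧ β = δ + Finsupp.single j 1

/-- `X^α ≺_B X^β`: one passes from `X^α` to `X^β` by a sequence of up moves. -/
def BorelLT {n : ℕ} : Mon n → Mon n → Prop := Relation.TransGen UpMove

section Ideals

variable {n : ℕ} {k : Type u} [Field k]

attribute [local instance] MvPolynomial.gradedAlgebra
attribute [local instance] MvPolynomial.weightedGradedAlgebra

/-- The exponents of the monomials that belong to `J`. -/
def monomialsIn (J : Ideal (Poly n k)) : Set (Mon n) := {α | monomial α (1 : k) ∈ J}

/-- `J` is generated by monomials. -/
def IsMonomialIdeal (J : Ideal (Poly n k)) : Prop :=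
  J = Ideal.span ((fun α : Mon n => monomial α (1 : k)) '' monomialsIn J)

/-- `J` is a strongly stable monomial ideal. -/
def IsStronglyStable (J : Ideal (Poly n k)) : Prop :=
  IsMonomialIdeal J ∧ ∀ α β : Mon n, BorelLT β α → β ∈ monomialsIn J → α ∈ monomialsIn J

/-- The monomial basis `B_J`: the monomials of `J` that are minimal for divisibility. -/
def basisMon (J : Ideal (Poly n k)) : Set (Mon n) :=
  {α | α ∈ monomialsIn J ∧ ∀ β ∈ monomialsIn J, β ≤ α → β = α}

/-- The sous-escalier `N(J)`. -/
def sousEscalier (J : Ideal (Poly n k)) : Set (Mon n) := {γ | γ ∉ monomialsIn J}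

/-- The homogeneous component `J_m`, as a vector space. -/
def degreePart (J : Ideal (Poly n k)) (m : ℕ) : Submodule k (Poly n k) :=
  J.restrictScalars k ⊓ homogeneousSubmodule (Fin (n + 1)) k m

/-- The homogeneous ideals `I` such that `N(J)` is a basis of the vector space `P/I`. -/
def family (J : Ideal (Poly n k)) : Set (Ideal (Poly n k)) :=
  {I | I.IsHomogeneous (homogeneousSubmodule (Fin (n + 1)) k) ∧
    LinearIndependent k
      (fun γ : sousEscalier J => Ideal.Quotient.mk I (monomial (γ : Mon n) (1 : k))) ∧
    Submodule.span k (Set.range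
      (fun γ : sousEscalier J => Ideal.Quotient.mk I (monomial (γ : Mon n) (1 : k)))) = ⊤}

/-- The index set of the variables `C_{αγ}`: pairs `(α, γ)` with `X^α ∈ B_J`, `X^γ ∈ N(J)` and
`|γ| = |α|`. -/
def Var (J : Ideal (Poly n k)) : Type :=
  {p : Mon n × Mon n // p.1 ∈ basisMon J ∧ p.2 ∈ sousEscalier J ∧ p.2.degree = p.1.degree}

open Classical in
/-- The marked polynomial `f_α = X^α - ∑ c_{αγ} X^γ`, the sum being over `X^γ ∈ N(J)` with
`|γ| = |α|`, with coefficients `c` in any commutative ring. -/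
def marked (J : Ideal (Poly n k)) {R : Type u} [CommRing R] (c : Var J → R) (α : basisMon J) :
    Poly n R :=
  monomial (α : Mon n) 1 -
    ∑ γ ∈ Finset.univ.finsuppAntidiag (α : Mon n).degree,
      if h : γ ∈ sousEscalier J ∧ γ.degree = (α : Mon n).degree then
        monomial γ (c ⟨(α, γ), α.2, h⟩)
      else 0

/-- Indices `(δ, α)` of the products `X^δ f_α`, `X^α ∈ B_J`. -/
abbrev Mult (J : Ideal (Poly n k)) : Type := Mon n × basisMon J

/-- The head `X^{δ+α}` of `X^δ f_α`. -/
def head {J : Ideal (Poly n k)} (p : Mult J) : Mon n := p.1 + p.2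

/-- The product `X^δ f_α`. -/
def multPoly {J : Ideal (Poly n k)} {R : Type u} [CommRing R] (c : Var J → R) (p : Mult J) :
    Poly n R :=
  monomial p.1 1 * marked J c p.2

/-- `X^{δ'} f_{α'} < X^δ f_α` if the first non-zero entry of `δ' - δ` is positive. -/
def MultLT {J : Ideal (Poly n k)} (p' p : Mult J) : Prop :=
  ∃ i, p.1 i < p'.1 i ∧ ∀ j < i, p'.1 j = p.1 j

/-- `X^δ f_α` is the minimum of the set of those `X^{δ'} f_{α'}` that have the same head. -/
def IsMin {J : Ideal (Poly n k)} (p : Mult J) : Prop :=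
  ∀ q : Mult J, head q = head p → q ≠ p → MultLT p q

/-- One step of `G**`-reduction: a monomial that appears in `h` and is the head of a minimal
`X^δ f_α` is rewritten by means of `X^δ f_α`. -/
def Step {J : Ideal (Poly n k)} {R : Type u} [CommRing R] (c : Var J → R) (h h' : Poly n R) :
    Prop :=
  ∃ p : Mult J, IsMin p ∧ head p ∈ h.support ∧
    h' = h - MvPolynomial.C (coeff (head p) h) * multPoly c p

/-- `h₀` is obtained from `h` by a complete `G**`-reduction: finitely many steps, and no monomial
of `h₀` is a multiple of an element of `B_J`. -/
def IsCompleteReduction {J : Ideal (Poly n k)} {R : Type u} [CommRing R] (c : Var J → R)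
    (h h₀ : Poly n R) : Prop :=
  Relation.ReflTransGen (Step c) h h₀ ∧ ∀ η ∈ h₀.support, ∀ α ∈ basisMon J, ¬ α ≤ η

/-- The index of the multiple of `f_α` with head `lcm(X^α, X^{α'})`. -/
def lcmMult {J : Ideal (Poly n k)} (α α' : basisMon J) : Mult J :=
  (((α : Mon n) ⊔ (α' : Mon n)) - α, α)

/-- The `S`-polynomial of `f_α` and `f_{α'}`. -/
def sPoly {J : Ideal (Poly n k)} {R : Type u} [CommRing R] (c : Var J → R)
    (α α' : basisMon J) : Poly n R :=
  multPoly c (lcmMult α α') - multPoly c (lcmMult α' α)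

/-- The ring `k[C]`. -/
abbrev CoeffRing (J : Ideal (Poly n k)) : Type u := MvPolynomial (Var J) k

/-- The coefficients of the generic marked set: `C_{αγ}` itself. -/
def generic (J : Ideal (Poly n k)) : Var J → CoeffRing J := MvPolynomial.X

/-- The matrix `A_m`: rows `X^β F_α` with `|β + α| = m`, columns the monomials of degree `m`. -/
def coeffMatrix (J : Ideal (Poly n k)) (m : ℕ) :
    Matrix {p : Mult J // (head p).degree = m} {δ : Mon n // δ.degree = m} (CoeffRing J) :=
  Matrix.of fun p δ => coeff (δ : Mon n) (multPoly (generic J) (p : Mult J))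

/-- The ideal `𝔄` of the minors of order `dim J_m + 1` of `A_m`, for all `m`. -/
def idealA (J : Ideal (Poly n k)) : Ideal (CoeffRing J) :=
  Ideal.span {d | ∃ (m : ℕ)
    (f : Fin (Module.finrank k (degreePart J m) + 1) ↪ {p : Mult J // (head p).degree = m})
    (g : Fin (Module.finrank k (degreePart J m) + 1) ↪ {δ : Mon n // δ.degree = m}),
    d = ((coeffMatrix J m).submatrix f g).det}

/-- The ideal generated by the coefficients of the polynomials `H_{αα'}`. -/
def idealR {J : Ideal (Poly n k)} (H : basisMon J → basisMon J → Poly n (CoeffRing J)) :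
    Ideal (CoeffRing J) :=
  Ideal.span {d | ∃ (α α' : basisMon J) (γ : Mon n), d = coeff γ (H α α')}

/-- The same, using only the `S`-polynomials `X^δ F_α - X^{δ'} F_{α'}` such that `X^δ F_α` is
minimal among those with its head. -/
def idealR' {J : Ideal (Poly n k)} (H : basisMon J → basisMon J → Poly n (CoeffRing J)) :
    Ideal (CoeffRing J) :=
  Ideal.span {d | ∃ (α α' : basisMon J) (γ : Mon n),
    IsMin (lcmMult α α') ∧ d = coeff γ (H α α')}

/-- The grading of `k[C]` over `ℤ^{n+1}`: `λ(C_{αγ}) = α - γ`. -/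
def lam (J : Ideal (Poly n k)) (v : Var J) : Fin (n + 1) → ℤ :=
  fun i => (v.1.1 i : ℤ) - (v.1.2 i : ℤ)

/-- Homogeneity of an ideal of `k[C]` for the grading `lam`. -/
def IsLamHomogeneous {J : Ideal (Poly n k)} (I : Ideal (CoeffRing J)) : Prop :=
  I.IsHomogeneous (weightedHomogeneousSubmodule k (lam J))

/-- The affine space `𝔸^N = Spec k[C]`. -/
def affineN (J : Ideal (Poly n k)) : Scheme.{u} := Spec (CommRingCat.of (CoeffRing J))

/-- The stratum of `J` as the scheme `Spec k[C]/𝔄`. -/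
def BSt (J : Ideal (Poly n k)) : Scheme.{u} :=
  Spec (CommRingCat.of (CoeffRing J ⧸ idealA J))

/-- The closed immersion of the stratum in `𝔸^N`. -/
def BSt.ι (J : Ideal (Poly n k)) : BSt J ⟶ affineN J :=
  Spec.map (CommRingCat.ofHom (Ideal.Quotient.mk (idealA J)))

/-- The prime ideal of `k[C]` of a point of the stratum, viewed as a point of `𝔸^N`. -/
def pointIdeal {J : Ideal (Poly n k)} (x : BSt J) : Ideal (CoeffRing J) :=
  PrimeSpectrum.asIdeal (R := CoeffRing J) ((BSt.ι J) x)

/-- The maximal ideal of `k[C]` of the point of `𝔸^N` with coordinates `c ∈ k^N`. -/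
def coordIdeal {J : Ideal (Poly n k)} (c : Var J → k) : Ideal (CoeffRing J) :=
  RingHom.ker (MvPolynomial.eval c)

end Ideals

end Stratum

end

/-!
Over any coefficient ring, the minimal products `X^δ f_α` are those in which no variable of `X^δ`
is larger than a variable of `X^α`, and every monomial of `J` is the head of exactly one of them
(the Eliahou–Kervaire decomposition). Reduction by minimal products strictly lowers the cofactors,
so it terminates, and the span of the minimal products is always complementary to the span of
`N(J)`. Hence `N(J)` is a basis modulo the ideal of the `f_α` if and only if all products lie in the
span of the minimal ones. This can be tested on the `S`-polynomials, which have to reduce to zero,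
and also on the minors: the minimal products of degree `m` are `dim J_m` rows, with a unitriangular
block in the columns of `J_m`, and the minors vanish if and only if all other rows are combinations
of these.

These equivalences hold with coefficients in every quotient of `k[C]`, so `𝔄`, `ℜ` and `ℜ'` lie in
the same ideals and coincide. Specialization at `c ∈ k^N` gives the closed points, by the
Nullstellensatz.
-/

noncomputable section

namespace Stratum

universe u

/-! ### Determinants and minors -/

section Minors

variable {S ι κ σ τ : Type*} [CommRing S]

theorem det_mul_eq_zero_of_card_lt [Fintype ι] [DecidableEq ι] [Fintype κ]
    (h : Fintype.card κ < Fintype.card ι) (A : Matrix ι κ S) (B : Matrix κ ι S) :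
    (A * B).det = 0 := by
  classical
  let τ := Fin (Fintype.card ι - Fintype.card κ)
  have e : κ ⊕ τ ≃ ι := Fintype.equivOfCardEq (by simp [τ]; omega)
  have hprod : A * B = (Matrix.fromCols A (0 : Matrix ι τ S)).submatrix id e.symm *
      (Matrix.fromRows B (0 : Matrix τ ι S)).submatrix e.symm id := by
    rw [Matrix.submatrix_mul_equiv, Matrix.fromCols_mul_fromRows]
    simp
  rw [hprod, Matrix.det_mul, Matrix.det_eq_zero_of_column_eq_zero (e (Sum.inr ⟨0, by omega⟩)),
    zero_mul]
  simp

theorem det_submatrix_eq_zero_of_not_injective_left [Fintype τ] [DecidableEq τ]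
    (M : Matrix ι κ S) {F : τ → ι} (hF : ¬ F.Injective) (G : τ → κ) :
    (M.submatrix F G).det = 0 := by
  obtain ⟨i, j, hij, hne⟩ := Function.not_injective_iff.mp hF
  exact Matrix.det_zero_of_row_eq hne (funext fun l => congrArg (M · (G l)) hij)

theorem det_submatrix_eq_zero_of_not_injective_right [Fintype τ] [DecidableEq τ]
    (M : Matrix ι κ S) (F : τ → ι) {G : τ → κ} (hG : ¬ G.Injective) :
    (M.submatrix F G).det = 0 := by
  rw [← Matrix.det_transpose, Matrix.transpose_submatrix]
  exact det_submatrix_eq_zero_of_not_injective_left _ hG F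

theorem det_submatrix_eq_zero_of_forall_embedding [Fintype τ] [DecidableEq τ] {r : ℕ}
    {M : Matrix ι κ S} (hM : ∀ (f : Fin r ↪ ι) (g : Fin r ↪ κ), (M.submatrix f g).det = 0)
    (hτ : Fintype.card τ = r) (F : τ → ι) (G : τ → κ) : (M.submatrix F G).det = 0 := by
  by_cases hF : F.Injective
  · by_cases hG : G.Injective
    · let e : Fin r ≃ τ := (Fintype.equivFinOfCardEq hτ).symm
      rw [← Matrix.det_submatrix_equiv_self e, Matrix.submatrix_submatrix]
      exact hM (e.toEmbedding.trans ⟨F, hF⟩) (e.toEmbedding.trans ⟨G, hG⟩)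
    · exact det_submatrix_eq_zero_of_not_injective_right M F hG
  · exact det_submatrix_eq_zero_of_not_injective_left M hF G

theorem isWeightedHomogeneous_det {W : Type*} [AddCommGroup W] {w : σ → W} [Fintype τ]
    [DecidableEq τ] {M : Matrix τ τ (MvPolynomial σ S)} {a b : τ → W}
    (hM : ∀ i j, IsWeightedHomogeneous w (M i j) (a i - b j)) :
    IsWeightedHomogeneous w M.det (∑ i, a i - ∑ j, b j) := by
  rw [Matrix.det_apply]
  refine IsWeightedHomogeneous.sum _ _ _ fun π _ => ?_
  have hprod : IsWeightedHomogeneous w (∏ i, M (π i) i) (∑ i, a i - ∑ j, b j) := by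
    rw [← Equiv.sum_comp π a, ← Finset.sum_sub_distrib]
    exact IsWeightedHomogeneous.prod _ _ _ fun i _ => hM (π i) i
  rcases Int.units_eq_one_or (Equiv.Perm.sign π) with hπ | hπ
  · rwa [hπ, one_smul]
  · rw [hπ, Units.neg_smul, one_smul]
    exact hprod.neg

variable [Fintype σ] {M : Matrix ι κ S} {f : σ → ι} {g : σ → κ}

-- Expanding the minor bordered by row `i` and column `j` along its invertible block leaves the
-- entry at `j` of row `i` minus a combination of the rows `f s` that does not depend on `j`.
theorem row_mem_span_of_bordered_minors [DecidableEq σ] (hu : IsUnit (M.submatrix f g).det) {i : ι}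
    (h : ∀ j, (M.submatrix (Sum.elim f fun _ : Unit => i)
      (Sum.elim g fun _ : Unit => j)).det = 0) :
    M i ∈ Submodule.span S (Set.range fun s => M (f s)) := by
  let _ := ((M.submatrix f g).isUnit_iff_isUnit_det.mpr hu).invertible
  let a : Matrix Unit σ S := (M.submatrix (fun _ : Unit => i) g) * ⅟(M.submatrix f g)
  refine (Submodule.mem_span_range_iff_exists_fun S).mpr ⟨a (), funext fun j => ?_⟩
  have hblock : M.submatrix (Sum.elim f fun _ : Unit => i) (Sum.elim g fun _ : Unit => j) =
      Matrix.fromBlocks (M.submatrix f g) (M.submatrix f fun _ => j)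
        (M.submatrix (fun _ => i) g) (M.submatrix (fun _ => i) fun _ => j) := by
    ext (_ | _) (_ | _) <;> rfl
  have hdet := h j
  rw [hblock, Matrix.det_fromBlocks₁₁, hu.mul_right_eq_zero, Matrix.det_unique, Matrix.sub_apply,
    sub_eq_zero, Matrix.mul_apply] at hdet
  simpa [a] using hdet.symm

theorem det_submatrix_eq_zero_of_rows_mem_span [Fintype τ] [DecidableEq τ]
    (hcard : Fintype.card σ < Fintype.card τ)
    (h : ∀ i, M i ∈ Submodule.span S (Set.range fun s => M (f s))) (F : τ → ι) (G : τ → κ) :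
    (M.submatrix F G).det = 0 := by
  choose a ha using fun i => (Submodule.mem_span_range_iff_exists_fun S).mp (h i)
  have hprod : M.submatrix F G = Matrix.of (fun t => a (F t)) * M.submatrix f G := by
    ext t t'
    simp [Matrix.mul_apply, ← ha (F t)]
  rw [hprod]
  exact det_mul_eq_zero_of_card_lt hcard _ _

theorem minors_eq_zero_iff_rows_mem_span [DecidableEq σ] (hu : IsUnit (M.submatrix f g).det) :
    (∀ (F : Fin (Fintype.card σ + 1) ↪ ι) (G : Fin (Fintype.card σ + 1) ↪ κ),
      (M.submatrix F G).det = 0) ↔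
    ∀ i, M i ∈ Submodule.span S (Set.range fun s => M (f s)) :=
  ⟨fun h _ => row_mem_span_of_bordered_minors hu fun _ =>
    det_submatrix_eq_zero_of_forall_embedding h (by simp) _ _,
  fun h F G => det_submatrix_eq_zero_of_rows_mem_span (by simp) h F G⟩

end Minors

section DershowitzManna

theorem isDershowitzMannaLT_map_val {ι α : Type*} [Preorder α] {A B : Finset ι}
    {f : ι → α} {b : ι} (hb : b ∈ B) (hbA : b ∉ A) (h : ∀ a ∈ A, a ∉ B → f a < f b) :
    Multiset.IsDershowitzMannaLT (A.val.map f) (B.val.map f) := by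
  classical
  have hval (A B : Finset ι) : A.val = (A ∩ B).val + (A \ B).val := by
    rw [← Finset.disjUnion_val _ _ (Finset.disjoint_sdiff_inter A B).symm,
      Finset.disjUnion_eq_union, Finset.union_comm, Finset.sdiff_union_inter]
  have hb' : f b ∈ (B \ A).val.map f :=
    Multiset.mem_map_of_mem f (Finset.mem_sdiff.mpr ⟨hb, hbA⟩)
  refine ⟨(A ∩ B).val.map f, (A \ B).val.map f, (B \ A).val.map f, fun h0 => ?_, ?_, ?_, ?_⟩
  · exact Multiset.notMem_zero _ (h0 ▸ hb')
  · rw [← Multiset.map_add, ← hval]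
  · rw [← Multiset.map_add, Finset.inter_comm, ← hval]
  · intro y hy
    obtain ⟨a, ha, rfl⟩ := Multiset.mem_map.mp hy
    obtain ⟨haA, haB⟩ := Finset.mem_sdiff.mp ha
    exact ⟨f b, hb', h a haA haB⟩

end DershowitzManna

/-! ### Ideals and quotients -/

section Quotients

theorem eq_of_le_of_codisjoint_of_disjoint {α : Type*} [Lattice α] [BoundedOrder α]
    [IsModularLattice α] {a b c : α} (hab : a ≤ b) (hac : Codisjoint a c) (hbc : Disjoint b c) :
    a = b :=
  eq_of_le_of_inf_le_of_le_sup hab (hbc.eq_bot.trans_le bot_le) (le_top.trans_eq hac.eq_top.symm)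

theorem ideal_eq_of_forall_le_ker_iff {A : Type u} [CommRing A] {I I' : Ideal A}
    (h : ∀ (S : Type u) [CommRing S] (φ : A →+* S), I ≤ RingHom.ker φ ↔ I' ≤ RingHom.ker φ) :
    I = I' := by
  have hI := (h (A ⧸ I) (Ideal.Quotient.mk I)).mp Ideal.mk_ker.ge
  have hI' := (h (A ⧸ I') (Ideal.Quotient.mk I')).mpr Ideal.mk_ker.ge
  rw [Ideal.mk_ker] at hI hI'
  exact le_antisymm hI' hI

variable {σ R : Type*} [CommRing R] (I : Ideal (MvPolynomial σ R)) (s : Set (σ →₀ ℕ))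

theorem ker_mkₐ_toLinearMap :
    LinearMap.ker (Ideal.Quotient.mkₐ R I).toLinearMap = I.restrictScalars R := by
  ext
  exact Ideal.Quotient.eq_zero_iff_mem

theorem linearIndependent_mk_monomial_iff_disjoint :
    LinearIndependent R (fun γ : s => Ideal.Quotient.mk I (monomial (γ : σ →₀ ℕ) (1 : R))) ↔
      Disjoint (I.restrictScalars R) (restrictSupport R s) := by
  let v : s → MvPolynomial σ R := fun γ => monomial (γ : σ →₀ ℕ) 1
  have hv : LinearIndependent R v :=
    (basisMonomials σ R).linearIndependent.comp _ Subtype.val_injective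
  have hmk : (fun γ : s => Ideal.Quotient.mk I (v γ)) =
      (Ideal.Quotient.mkₐ R I).toLinearMap ∘ v := rfl
  rw [restrictSupport_eq_span, Set.image_eq_range, disjoint_comm, ← ker_mkₐ_toLinearMap, hmk]
  exact ⟨Submodule.range_ker_disjoint, hv.map⟩

theorem span_mk_monomial_eq_top_iff_codisjoint :
    Submodule.span R (Set.range
      (fun γ : s => Ideal.Quotient.mk I (monomial (γ : σ →₀ ℕ) (1 : R)))) = ⊤ ↔
      Codisjoint (I.restrictScalars R) (restrictSupport R s) := by
  have hrange : LinearMap.range (Ideal.Quotient.mkₐ R I).toLinearMap = ⊤ :=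
    LinearMap.range_eq_top.mpr Ideal.Quotient.mk_surjective
  rw [codisjoint_comm, codisjoint_iff, ← ker_mkₐ_toLinearMap, ← LinearMap.map_eq_top_iff hrange,
    restrictSupport_eq_span, Submodule.map_span, ← Set.image_comp, Set.image_eq_range]
  rfl

end Quotients

/-! ### Star products -/

section Star

variable {n : ℕ} {k : Type u} [Field k] {J : Ideal (Poly n k)}

theorem monomialsIn_mono {μ ν : Mon n} (h : μ ≤ ν) (hμ : μ ∈ monomialsIn J) :
    ν ∈ monomialsIn J := by
  obtain ⟨δ, rfl⟩ := exists_add_of_le h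
  have := J.mul_mem_right (monomial δ (1 : k)) hμ
  rwa [monomial_mul, one_mul] at this

theorem exists_basisMon_le {μ : Mon n} (hμ : μ ∈ monomialsIn J) : ∃ α ∈ basisMon J, α ≤ μ := by
  obtain ⟨α, hαμ, hα⟩ := exists_minimal_le_of_wellFoundedLT (· ∈ monomialsIn J) μ hμ
  exact ⟨α, ⟨hα.1, fun β hβ h => le_antisymm h (hα.2 hβ h)⟩, hαμ⟩

theorem finite_basisMon (J : Ideal (Poly n k)) : (basisMon J).Finite :=
  WellQuasiOrderedLE.finite_of_isAntichain fun α hα _ hβ hne hle => hne (hβ.2 α hα.1 hle)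

instance (J : Ideal (Poly n k)) : Finite (Var J) := by
  have h : (⋃ α ∈ basisMon J, (Prod.mk α) '' {γ : Mon n | γ.degree = α.degree}).Finite :=
    (finite_basisMon J).biUnion fun α _ => (Finsupp.finite_of_degree_eq _).image _
  exact (h.subset (t := {p : Mon n × Mon n | p.1 ∈ basisMon J ∧ p.2 ∈ sousEscalier J ∧
    p.2.degree = p.1.degree}) fun p hp => Set.mem_biUnion hp.1 ⟨p.2, hp.2.2, rfl⟩).to_subtype

theorem IsStronglyStable.add_single_mem (hJ : IsStronglyStable J) {δ : Mon n}
    {i j : Fin (n + 1)} (hij : i < j) (h : δ + Finsupp.single i 1 ∈ monomialsIn J) :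
    δ + Finsupp.single j 1 ∈ monomialsIn J :=
  hJ.2 _ _ (Relation.TransGen.single ⟨δ, i, j, hij, rfl, rfl⟩) h

theorem head_mem_monomialsIn (p : Mult J) : head p ∈ monomialsIn J :=
  monomialsIn_mono le_add_self p.2.2.1

theorem fst_apply_add_snd_apply_eq {p : Mult J} {δ μ : Mon n} (h : head p = δ + μ)
    (i : Fin (n + 1)) : p.1 i + (p.2 : Mon n) i = δ i + μ i :=
  DFunLike.congr_fun h i

theorem mult_eq_of_head_eq_of_le {p q : Mult J} (h : head p = head q)
    (hle : (p.2 : Mon n) ≤ q.2) : p = q := by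
  have hsnd : p.2 = q.2 := Subtype.ext (q.2.2.2 _ p.2.2.1 hle)
  refine Prod.ext ?_ hsnd
  rw [head, head, hsnd] at h
  exact add_right_cancel h

theorem multLT_iff_toLex_lt {p q : Mult J} : MultLT p q ↔ toLex q.1 < toLex p.1 := by
  simp only [MultLT, Finsupp.Lex.lt_iff, ofLex_toLex, and_comm, eq_comm]

theorem IsMin.eq_of_head_eq {p q : Mult J} (hp : IsMin p) (hq : IsMin q)
    (h : head p = head q) : p = q := by
  by_contra hpq
  exact (multLT_iff_toLex_lt.mp (hp q h.symm (Ne.symm hpq))).asymm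
    (multLT_iff_toLex_lt.mp (hq p h hpq))

/-- `X^δ f_α` is a star product if no variable of `X^δ` is larger than a variable of `X^α`. For a
strongly stable `J` these are the minimal products, and every monomial of `J` is the head of exactly
one of them: its Eliahou–Kervaire decomposition. -/
def IsStar (p : Mult J) : Prop := ∀ i j, p.1 i ≠ 0 → (p.2 : Mon n) j ≠ 0 → i ≤ j

theorem IsStar.snd_le_of_toColex_le {p : Mult J} (hp : IsStar p) {δ μ : Mon n}
    (h : head p = δ + μ) (hle : toColex δ ≤ toColex p.1) : (p.2 : Mon n) ≤ μ := by
  rcases eq_or_lt_of_le hle with heq | hlt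
  · rw [toColex.injective heq, head] at h
    exact (add_left_cancel h).le
  obtain ⟨i, hgt, hi⟩ := Finsupp.Colex.lt_iff.mp hlt
  simp only [ofColex_toColex] at hgt hi
  intro j
  have hj := fst_apply_add_snd_apply_eq h j
  rcases lt_trichotomy i j with hij | rfl | hij
  · have := hgt j hij
    omega
  · omega
  · have : (p.2 : Mon n) j = 0 := by
      by_contra hne
      exact (hp i j (by omega) hne).not_gt hij
    omega

theorem IsStar.le_snd_of_toLex_le {p : Mult J} (hp : IsStar p) {δ μ : Mon n}
    (h : head p = δ + μ) (hle : toLex p.1 ≤ toLex δ) : μ ≤ p.2 := by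
  rcases eq_or_lt_of_le hle with heq | hlt
  · rw [← toLex.injective heq, head] at h
    exact (add_left_cancel h).ge
  obtain ⟨i, hlt, hi⟩ := Finsupp.Lex.lt_iff.mp hlt
  simp only [ofLex_toLex] at hlt hi
  intro j
  have hj := fst_apply_add_snd_apply_eq h j
  rcases lt_trichotomy i j with hij | rfl | hij
  · have hsnd := fst_apply_add_snd_apply_eq h i
    have : p.1 j = 0 := by
      by_contra hne
      exact (hp j i hne (by omega)).not_gt hij
    omega
  · omega
  · have := hlt j hij
    omega

theorem IsStar.toColex_lt {p q : Mult J} (hp : IsStar p) (h : head p = head q) (hne : p ≠ q) :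
    toColex p.1 < toColex q.1 := by
  by_contra! hle
  exact hne (mult_eq_of_head_eq_of_le h (hp.snd_le_of_toColex_le h hle))

theorem IsStar.isMin {p : Mult J} (hp : IsStar p) : IsMin p := by
  intro q h hne
  rw [multLT_iff_toLex_lt]
  by_contra! hle
  exact hne (mult_eq_of_head_eq_of_le h (hp.le_snd_of_toLex_le h.symm hle))

theorem IsStar.eq_of_head_eq {p q : Mult J} (hp : IsStar p) (hq : IsStar q)
    (h : head p = head q) : p = q :=
  hp.isMin.eq_of_head_eq hq.isMin h

theorem IsStronglyStable.exists_eq_add_single (hJ : IsStronglyStable J) {μ : Mon n}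
    (hμ : μ ∈ monomialsIn J) (hbasis : μ ∉ basisMon J) :
    ∃ ν ∈ monomialsIn J, ∃ i, μ = ν + Finsupp.single i 1 ∧ ∀ j, μ j ≠ 0 → i ≤ j := by
  obtain ⟨β, hβ, hle, hne⟩ : ∃ β ∈ monomialsIn J, β ≤ μ ∧ β ≠ μ := by
    by_contra! h
    exact hbasis ⟨hμ, h⟩
  obtain ⟨j, hj⟩ : ∃ j, β j < μ j := by
    by_contra! h
    exact hne (le_antisymm hle h)
  obtain ⟨ν, rfl⟩ : ∃ ν, μ = β + Finsupp.single j 1 + ν := by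
    refine exists_add_of_le fun l => ?_
    by_cases hl : l = j
    · subst hl
      simpa using hj
    · simpa [Finsupp.single_eq_of_ne hl] using hle l
  set μ := β + Finsupp.single j 1 + ν with hμ_def
  have hj : j ∈ μ.support := by simp [hμ_def]
  obtain ⟨i, hi, hmin⟩ := Finset.exists_min_image μ.support id ⟨j, hj⟩
  replace hmin : ∀ l, μ l ≠ 0 → i ≤ l := fun l hl => hmin l (Finsupp.mem_support_iff.mpr hl)
  have hβν : β + ν ∈ monomialsIn J := monomialsIn_mono le_self_add hβ
  have hμj : μ = β + ν + Finsupp.single j 1 := add_right_comm _ _ _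
  rcases (hmin j (Finsupp.mem_support_iff.mp hj)).eq_or_lt with rfl | hij
  · exact ⟨β + ν, hβν, i, hμj, hmin⟩
  obtain ⟨ε, hε⟩ : ∃ ε, β + ν = ε + Finsupp.single i 1 := by
    refine le_iff_exists_add'.mp (Finsupp.single_le_iff.mpr ?_)
    rw [hμj, Finsupp.mem_support_iff, Finsupp.add_apply, Finsupp.single_eq_of_ne hij.ne] at hi
    omega
  refine ⟨ε + Finsupp.single j 1, hJ.add_single_mem hij (hε ▸ hβν), i, ?_, hmin⟩
  rw [hμj, hε, add_right_comm]

theorem exists_isStar (hJ : IsStronglyStable J) {μ : Mon n} (hμ : μ ∈ monomialsIn J) :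
    ∃ p : Mult J, IsStar p ∧ head p = μ := by
  induction μ using WellFoundedLT.induction with
  | ind μ ih =>
    by_cases hbasis : μ ∈ basisMon J
    · exact ⟨(0, ⟨μ, hbasis⟩), fun i _ hi => absurd rfl hi, zero_add μ⟩
    obtain ⟨ν, hν, i, rfl, hmin⟩ := hJ.exists_eq_add_single hμ hbasis
    obtain ⟨p, hp, rfl⟩ := ih ν (lt_add_of_pos_right ν (by simp [pos_iff_ne_zero])) hν
    refine ⟨(p.1 + Finsupp.single i 1, p.2), fun l j hl hj => ?_, add_right_comm _ _ _⟩
    by_cases hli : l = i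
    · subst hli
      exact hmin j (by simp [head, hj])
    · exact hp l j (by simpa [Finsupp.single_eq_of_ne hli] using hl) hj

theorem isMin_iff_isStar (hJ : IsStronglyStable J) {p : Mult J} : IsMin p ↔ IsStar p := by
  refine ⟨fun hp => ?_, IsStar.isMin⟩
  obtain ⟨q, hq, hqp⟩ := exists_isStar hJ (head_mem_monomialsIn p)
  exact hq.isMin.eq_of_head_eq hp hqp ▸ hq

/-- The star product with head a given monomial of a strongly stable ideal. -/
def starMult (hJ : IsStronglyStable J) (μ : monomialsIn J) : Mult J :=
  (exists_isStar hJ μ.2).choose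

theorem isStar_starMult (hJ : IsStronglyStable J) (μ : monomialsIn J) : IsStar (starMult hJ μ) :=
  (exists_isStar hJ μ.2).choose_spec.1

theorem head_starMult (hJ : IsStronglyStable J) (μ : monomialsIn J) :
    head (starMult hJ μ) = μ :=
  (exists_isStar hJ μ.2).choose_spec.2

theorem IsStar.starMult_eq {p : Mult J} (hp : IsStar p) (hJ : IsStronglyStable J)
    {μ : monomialsIn J} (h : head p = μ) : starMult hJ μ = p :=
  (isStar_starMult hJ μ).eq_of_head_eq hp ((head_starMult hJ μ).trans h.symm)

theorem lcmMult_eq_of_disjoint {p q : Mult J} (h : head p = head q) (hd : Disjoint p.1 q.1) :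
    lcmMult p.2 q.2 = p := by
  refine Prod.ext (Finsupp.ext fun i => ?_) rfl
  have hi := fst_apply_add_snd_apply_eq h i
  have hdi := DFunLike.congr_fun hd.eq_bot i
  simp only [Finsupp.inf_apply, bot_eq_zero, Finsupp.coe_zero, Pi.zero_apply] at hdi
  simp only [lcmMult, Finsupp.tsub_apply, Finsupp.sup_apply]
  omega

theorem disjoint_single_fst {q : Mult J} {i : Fin (n + 1)} {α : basisMon J}
    (h : head q = head ((Finsupp.single i 1, α) : Mult J)) (hne : q ≠ (Finsupp.single i 1, α)) :
    Disjoint (Finsupp.single i 1) q.1 := by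
  rw [Finsupp.disjoint_iff, Finsupp.support_single _ one_ne_zero,
    Finset.disjoint_singleton_left]
  intro hi
  obtain ⟨ε, hε⟩ : ∃ ε, q.1 = Finsupp.single i 1 + ε := exists_add_of_le
    (Finsupp.single_le_iff.mpr (Nat.one_le_iff_ne_zero.mpr (Finsupp.mem_support_iff.mp hi)))
  have hα : (α : Mon n) = ε + q.2 := by
    rw [head, head, hε, add_assoc] at h
    exact (add_left_cancel h).symm
  exact hne (mult_eq_of_head_eq_of_le h (hα ▸ le_add_self))

end Star

/-! ### Marked polynomials and their multiples -/

section Coefficients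

variable {n : ℕ} {k : Type u} [Field k] {J : Ideal (Poly n k)} {R : Type u} [CommRing R]
  (c : Var J → R)

open Classical in
theorem coeff_marked (α : basisMon J) (μ : Mon n) :
    coeff μ (marked J c α) = (if μ = α then 1 else 0) -
      if h : μ ∈ sousEscalier J ∧ μ.degree = (α : Mon n).degree then c ⟨(α, μ), α.2, h⟩ else 0 := by
  rw [marked, coeff_sub, coeff_monomial, coeff_sum]
  congr 1
  · simp only [eq_comm]
  · rw [Finset.sum_eq_single μ]
    · split_ifs <;> simp
    · intro γ _ hγ
      split_ifs <;> simp [coeff_monomial, hγ]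
    · intro hμ
      rw [dif_neg, coeff_zero]
      rintro ⟨-, h⟩
      exact hμ (by simpa [Finset.mem_finsuppAntidiag, Finsupp.degree_eq_sum] using h)

theorem coeff_marked_self (α : basisMon J) : coeff (α : Mon n) (marked J c α) = 1 := by
  rw [coeff_marked, if_pos rfl, dif_neg (fun h => h.1 α.2.1), sub_zero]

theorem coeff_marked_var (v : Var J) :
    coeff v.1.2 (marked J c ⟨v.1.1, v.2.1⟩) = - c v := by
  rw [coeff_marked, if_neg, dif_pos v.2.2, zero_sub]
  · rfl
  · exact fun h => v.2.2.1 (h ▸ v.2.1.1)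

variable {c} in
theorem eq_or_mem_sousEscalier_of_coeff_marked_ne_zero {α : basisMon J} {μ : Mon n}
    (hμ : coeff μ (marked J c α) ≠ 0) :
    μ = α ∨ μ ∈ sousEscalier J ∧ μ.degree = (α : Mon n).degree := by
  rw [coeff_marked] at hμ
  by_contra! h
  exact hμ (by rw [if_neg h.1, dif_neg (fun h' => h.2 h'.1 h'.2), sub_zero])

theorem isHomogeneous_marked (α : basisMon J) :
    (marked J c α).IsHomogeneous (α : Mon n).degree := by
  intro μ hμ
  change Finsupp.weight (fun _ => 1) μ = _
  rw [← Finsupp.degree_eq_weight_one]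
  rcases eq_or_mem_sousEscalier_of_coeff_marked_ne_zero hμ with rfl | h
  · rfl
  · exact h.2

theorem isHomogeneous_multPoly (p : Mult J) : (multPoly c p).IsHomogeneous (head p).degree := by
  rw [head, map_add]
  exact (isHomogeneous_monomial 1 rfl).mul (isHomogeneous_marked c p.2)

theorem multPoly_add (ε δ : Mon n) (α : basisMon J) :
    multPoly c (ε + δ, α) = monomial ε 1 * multPoly c (δ, α) := by
  rw [multPoly, multPoly, ← mul_assoc, monomial_mul, one_mul]

theorem coeff_multPoly_add (p : Mult J) (μ : Mon n) :
    coeff (p.1 + μ) (multPoly c p) = coeff μ (marked J c p.2) := by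
  rw [multPoly, coeff_monomial_mul, one_mul]

theorem coeff_multPoly_head (p : Mult J) : coeff (head p) (multPoly c p) = 1 := by
  rw [head, coeff_multPoly_add, coeff_marked_self]

variable {c}

theorem exists_eq_add_of_coeff_multPoly_ne_zero {p : Mult J} {μ : Mon n}
    (hμ : coeff μ (multPoly c p) ≠ 0) : ∃ γ, μ = p.1 + γ ∧ coeff γ (marked J c p.2) ≠ 0 := by
  by_cases h : p.1 ≤ μ
  · obtain ⟨γ, rfl⟩ := exists_add_of_le h
    exact ⟨γ, rfl, by rwa [coeff_multPoly_add] at hμ⟩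
  · rw [multPoly, coeff_monomial_mul', if_neg h] at hμ
    exact absurd rfl hμ

theorem IsStar.toColex_lt_of_coeff_multPoly_ne_zero {p q : Mult J} (hq : IsStar q)
    (hne : head q ≠ head p) (hcoeff : coeff (head q) (multPoly c p) ≠ 0) :
    toColex q.1 < toColex p.1 := by
  obtain ⟨γ, hγ, hγc⟩ := exists_eq_add_of_coeff_multPoly_ne_zero hcoeff
  rcases eq_or_mem_sousEscalier_of_coeff_marked_ne_zero hγc with rfl | ⟨hγN, -⟩
  · exact absurd hγ hne
  · by_contra! hle
    exact hγN (monomialsIn_mono (hq.snd_le_of_toColex_le hγ hle) q.2.2.1)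

variable {S : Type u} [CommRing S] (φ : R →+* S)

theorem map_marked (α : basisMon J) : map φ (marked J c α) = marked J (φ ∘ c) α := by
  ext μ
  rw [coeff_map, coeff_marked, coeff_marked, map_sub]
  congr 1
  · split_ifs <;> simp
  · split_ifs
    · rfl
    · exact map_zero φ

theorem map_multPoly (p : Mult J) : map φ (multPoly c p) = multPoly (φ ∘ c) p := by
  rw [multPoly, map_mul, map_monomial, map_one, map_marked, multPoly]

theorem map_sPoly (α α' : basisMon J) : map φ (sPoly c α α') = sPoly (φ ∘ c) α α' := by
  rw [sPoly, map_sub, map_multPoly, map_multPoly, sPoly]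

end Coefficients

/-! ### Reduction by star products -/

section Reduction

variable {n : ℕ} {k : Type u} [Field k] {J : Ideal (Poly n k)} {R : Type u} [CommRing R]

/-- The span of the star products with head in `P`: the polynomials that are subtracted when a
polynomial with monomials in `P` is reduced. -/
def starSpan (c : Var J → R) (P : Set (Mon n)) : Submodule R (Poly n R) :=
  Submodule.span R (multPoly c '' {p | IsStar p ∧ head p ∈ P})

/-- `P` is closed under reduction if it contains all monomials of every star product with head in
`P`; reductions then do not leave the polynomials with monomials in `P`. -/
def ReductionClosed (c : Var J → R) (P : Set (Mon n)) : Prop :=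
  ∀ p, IsStar p → head p ∈ P → multPoly c p ∈ restrictSupport R P

/-- The monomials that are not in `J`, or are the head of a star product whose cofactor is smaller
than `b`. -/
def headsBelow (J : Ideal (Poly n k)) (b : Colex (Mon n)) : Set (Mon n) :=
  {μ | ∀ p : Mult J, IsStar p → head p = μ → toColex p.1 < b}

variable {c : Var J → R} {P Q : Set (Mon n)}

theorem starSpan_mono (h : P ⊆ Q) : starSpan c P ≤ starSpan c Q :=
  Submodule.span_mono (Set.image_mono fun _ hp => ⟨hp.1, h hp.2⟩)

theorem IsStar.multPoly_mem_starSpan {p : Mult J} (hp : IsStar p) (hP : head p ∈ P) :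
    multPoly c p ∈ starSpan c P :=
  Submodule.subset_span ⟨p, ⟨hp, hP⟩, rfl⟩

theorem map_mem_starSpan {S : Type u} [CommRing S] (φ : R →+* S) {h : Poly n R}
    (hh : h ∈ starSpan c P) : map φ h ∈ starSpan (φ ∘ c) P := by
  induction hh using Submodule.span_induction with
  | mem x hx =>
    obtain ⟨p, hp, rfl⟩ := hx
    exact map_multPoly (c := c) φ p ▸ hp.1.multPoly_mem_starSpan hp.2
  | zero => exact map_zero (map φ) ▸ zero_mem _
  | add x y _ _ hx hy => exact map_add (map φ) x y ▸ add_mem hx hy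
  | smul a x _ hx =>
    rw [smul_eq_C_mul, map_mul, map_C, ← smul_eq_C_mul]
    exact Submodule.smul_mem _ _ hx

theorem mem_restrictSupport_iff_coeff {h : Poly n R} :
    h ∈ restrictSupport R P ↔ ∀ μ, coeff μ h ≠ 0 → μ ∈ P := by
  simp only [mem_restrictSupport_iff, Set.subset_def, Finset.mem_coe, mem_support_iff]

theorem mem_restrictSupport_degree_iff {h : Poly n R} {m : ℕ} :
    h ∈ restrictSupport R {μ | μ.degree = m} ↔ h.IsHomogeneous m := by
  simp only [mem_restrictSupport_iff_coeff, IsHomogeneous, IsWeightedHomogeneous,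
    Set.mem_ofPred_eq, Finsupp.degree_eq_weight_one]
  rfl

variable (c) in
theorem reductionClosed_univ : ReductionClosed c Set.univ := fun _ _ _ => Set.subset_univ _

variable (c) in
theorem reductionClosed_degree (m : ℕ) : ReductionClosed c {μ | μ.degree = m} := by
  intro p _ hp
  exact mem_restrictSupport_degree_iff.mpr (hp ▸ isHomogeneous_multPoly c p)

variable (c) in
theorem reductionClosed_headsBelow (b : Colex (Mon n)) : ReductionClosed c (headsBelow J b) := by
  intro p hp hpb
  refine mem_restrictSupport_iff_coeff.mpr fun μ hμ q hq hqμ => ?_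
  by_cases hne : head q = head p
  · exact hpb q hq hne
  · exact (hq.toColex_lt_of_coeff_multPoly_ne_zero hne (hqμ ▸ hμ)).trans (hpb p hp rfl)

theorem ReductionClosed.starSpan_le (hP : ReductionClosed c P) :
    starSpan c P ≤ restrictSupport R P := by
  rw [starSpan, Submodule.span_le]
  rintro _ ⟨p, hp, rfl⟩
  exact hP p hp.1 hp.2

theorem ReductionClosed.sub_mem_starSpan (hP : ReductionClosed c P) (hJ : IsStronglyStable J)
    {h h' : Poly n R} (hred : Relation.ReflTransGen (Step c) h h')
    (hh : h ∈ restrictSupport R P) : h - h' ∈ starSpan c P := by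
  induction hred with
  | refl => exact sub_self h ▸ zero_mem _
  | @tail g g' _ hstep ih =>
    obtain ⟨p, hp, hsupp, rfl⟩ := hstep
    have hg : g ∈ restrictSupport R P := by
      simpa only [sub_sub_cancel] using sub_mem hh (hP.starSpan_le ih)
    rw [sub_sub_eq_add_sub, add_sub_right_comm, C_mul']
    exact add_mem ih (Submodule.smul_mem _ _
      (((isMin_iff_isStar hJ).mp hp).multPoly_mem_starSpan (hg hsupp)))

open Classical in
/-- The multiset of the cofactors of the star products whose heads are monomials of `h`. It
decreases in the Dershowitz–Manna order when `h` is reduced. -/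
def reducibleHeads (hJ : IsStronglyStable J) (h : Poly n R) : Multiset (Colex (Mon n)) :=
  (h.support.subtype (· ∈ monomialsIn J)).val.map fun μ => toColex (starMult hJ μ).1

theorem Step.reducibleHeads_lt (hJ : IsStronglyStable J) {h h' : Poly n R} (hstep : Step c h h') :
    (reducibleHeads hJ h').IsDershowitzMannaLT (reducibleHeads hJ h) := by
  classical
  obtain ⟨p, hp, hsupp, rfl⟩ := hstep
  have hcoeff (μ : Mon n) : coeff μ (h - C (coeff (head p) h) * multPoly c p) =
      coeff μ h - coeff (head p) h * coeff μ (multPoly c p) := by rw [coeff_sub, coeff_C_mul]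
  have hstar : starMult hJ ⟨head p, head_mem_monomialsIn p⟩ = p :=
    ((isMin_iff_isStar hJ).mp hp).starMult_eq hJ rfl
  refine isDershowitzMannaLT_map_val (b := ⟨head p, head_mem_monomialsIn p⟩)
    (Finset.mem_subtype.mpr hsupp) ?_ ?_
  · rw [Finset.mem_subtype, notMem_support_iff, hcoeff, coeff_multPoly_head, mul_one, sub_self]
  · intro μ hμ hμh
    rw [Finset.mem_subtype, mem_support_iff, hcoeff] at hμ
    rw [Finset.mem_subtype, notMem_support_iff] at hμh
    rw [hμh, zero_sub, neg_ne_zero] at hμ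
    rw [hstar]
    refine (isStar_starMult hJ μ).toColex_lt_of_coeff_multPoly_ne_zero (c := c) (fun heq => ?_) ?_
    · rw [head_starMult] at heq
      exact mem_support_iff.mp hsupp (heq ▸ hμh)
    · exact head_starMult hJ μ ▸ right_ne_zero_of_mul hμ

theorem exists_isCompleteReduction (hJ : IsStronglyStable J) (c : Var J → R) (h : Poly n R) :
    ∃ h₀, IsCompleteReduction c h h₀ := by
  induction h using (InvImage.wf (reducibleHeads hJ)
    (Multiset.wellFounded_isDershowitzMannaLT (α := Colex (Mon n)))).induction with
  | h h ih =>
    by_cases hc : ∀ η ∈ h.support, ∀ α ∈ basisMon J, ¬ α ≤ η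
    · exact ⟨h, .refl, hc⟩
    · push Not at hc
      obtain ⟨η, hη, α, hα, hle⟩ := hc
      obtain ⟨p, hp, rfl⟩ := exists_isStar hJ (monomialsIn_mono hle hα.1)
      have hstep : Step c h (h - C (coeff (head p) h) * multPoly c p) := ⟨p, hp.isMin, hη, rfl⟩
      obtain ⟨h₀, hred, hcompl⟩ := ih _ (hstep.reducibleHeads_lt hJ)
      exact ⟨h₀, .head hstep hred, hcompl⟩

theorem IsCompleteReduction.mem_restrictSupport {h h₀ : Poly n R}
    (hc : IsCompleteReduction c h h₀) : h₀ ∈ restrictSupport R (sousEscalier J) := by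
  intro μ hμ hμJ
  obtain ⟨α, hα, hle⟩ := exists_basisMon_le hμJ
  exact hc.2 μ hμ α hα hle

theorem codisjoint_starSpan (hJ : IsStronglyStable J) (c : Var J → R) :
    Codisjoint (starSpan c Set.univ) (restrictSupport R (sousEscalier J)) := by
  refine codisjoint_iff.mpr (Submodule.eq_top_iff'.mpr fun h => ?_)
  obtain ⟨h₀, hred⟩ := exists_isCompleteReduction hJ c h
  have hsub := (reductionClosed_univ c).sub_mem_starSpan hJ hred.1 (Set.subset_univ _)
  exact Submodule.mem_sup.mpr ⟨h - h₀, hsub, h₀, hred.mem_restrictSupport, sub_add_cancel h h₀⟩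

variable (c) in
theorem disjoint_starSpan :
    Disjoint (starSpan c Set.univ) (restrictSupport R (sousEscalier J)) := by
  refine Submodule.disjoint_def.mpr fun w hw hN => ?_
  obtain ⟨l, hl, rfl⟩ := (Finsupp.mem_span_image_iff_linearCombination R).mp hw
  by_contra hne
  have hl0 : l.support.Nonempty := by
    refine Finsupp.support_nonempty_iff.mpr fun h0 => hne ?_
    rw [h0, map_zero]
  -- The head of a product with maximal cofactor does not cancel.
  obtain ⟨p, hpl, hmax⟩ := Finset.exists_max_image l.support (fun p => toColex p.1) hl0
  have hstar : IsStar p := (hl hpl).1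
  refine mem_restrictSupport_iff_coeff.mp hN (head p) ?_ (head_mem_monomialsIn p)
  rw [Finsupp.linearCombination_apply, Finsupp.sum, coeff_sum, Finset.sum_eq_single p]
  · rw [coeff_smul, coeff_multPoly_head, smul_eq_mul, mul_one]
    exact Finsupp.mem_support_iff.mp hpl
  · intro q hq hqp
    rw [coeff_smul, smul_eq_mul]
    by_contra hcoeff
    exact (hmax q hq).not_gt (hstar.toColex_lt_of_coeff_multPoly_ne_zero
      (fun h => hqp ((hl hq).1.eq_of_head_eq hstar h.symm)) (right_ne_zero_of_mul hcoeff))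
  · exact fun h => absurd hpl h

theorem isCompl_starSpan (hJ : IsStronglyStable J) (c : Var J → R) :
    IsCompl (starSpan c Set.univ) (restrictSupport R (sousEscalier J)) :=
  ⟨disjoint_starSpan c, codisjoint_starSpan hJ c⟩

theorem ReductionClosed.mem_starSpan (hP : ReductionClosed c P) (hJ : IsStronglyStable J)
    {h : Poly n R} (hh : h ∈ restrictSupport R P) (huniv : h ∈ starSpan c Set.univ) :
    h ∈ starSpan c P := by
  obtain ⟨h₀, hred⟩ := exists_isCompleteReduction hJ c h
  have hsub := hP.sub_mem_starSpan hJ hred.1 hh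
  have h₀_mem : h₀ ∈ starSpan c Set.univ := by
    simpa only [sub_sub_cancel] using sub_mem huniv (starSpan_mono (Set.subset_univ P) hsub)
  rwa [Submodule.disjoint_def.mp (disjoint_starSpan c) h₀ h₀_mem hred.mem_restrictSupport,
    sub_zero] at hsub

end Reduction

/-! ### Marked bases and `S`-polynomials -/

section MarkedBasis

variable {n : ℕ} {k : Type u} [Field k] {J : Ideal (Poly n k)} {R S : Type u} [CommRing R]
  [CommRing S]

/-- The marked polynomials `f_α` form a marked basis if the monomials outside `J` are a basis of
the quotient by the ideal they generate. The condition is stated before passing to the quotient. -/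
def IsMarkedBasis (c : Var J → R) : Prop :=
  IsCompl ((Ideal.span (Set.range (marked J c))).restrictScalars R)
    (restrictSupport R (sousEscalier J))

theorem restrictScalars_span_marked (c : Var J → R) :
    (Ideal.span (Set.range (marked J c))).restrictScalars R =
      Submodule.span R (Set.range (multPoly c)) := by
  have hspan : Submodule.span R (Set.range fun δ : Mon n => monomial δ (1 : R)) = ⊤ := by
    simpa only [coe_basisMonomials] using (basisMonomials (Fin (n + 1)) R).span_eq
  rw [Ideal.span, ← Submodule.span_smul_of_span_eq_top hspan, Set.range_smul_range]
  rfl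

theorem starSpan_le_span_marked (c : Var J → R) (P : Set (Mon n)) :
    starSpan c P ≤ (Ideal.span (Set.range (marked J c))).restrictScalars R := by
  rw [restrictScalars_span_marked]
  exact Submodule.span_mono (Set.image_subset_range _ _)

theorem isMarkedBasis_iff (hJ : IsStronglyStable J) {c : Var J → R} :
    IsMarkedBasis c ↔ ∀ p : Mult J, multPoly c p ∈ starSpan c Set.univ := by
  have hle := starSpan_le_span_marked c Set.univ
  have hcompl := isCompl_starSpan hJ c
  have hiff : (∀ p : Mult J, multPoly c p ∈ starSpan c Set.univ) ↔
      (Ideal.span (Set.range (marked J c))).restrictScalars R ≤ starSpan c Set.univ := by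
    rw [restrictScalars_span_marked, Submodule.span_le, Set.range_subset_iff]
    rfl
  rw [hiff]
  refine ⟨fun h => ?_, fun h => by rwa [IsMarkedBasis, ← hle.antisymm h]⟩
  exact (eq_of_le_of_codisjoint_of_disjoint hle hcompl.codisjoint h.disjoint).ge

theorem IsMarkedBasis.sPoly_mem_starSpan (hJ : IsStronglyStable J) {c : Var J → R}
    (hc : IsMarkedBasis c) (α α' : basisMon J) : sPoly c α α' ∈ starSpan c Set.univ :=
  sub_mem ((isMarkedBasis_iff hJ).mp hc _) ((isMarkedBasis_iff hJ).mp hc _)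

theorem IsStar.sub_mem_restrictSupport_headsBelow {p q : Mult J} {c : Var J → R} (hq : IsStar q)
    (h : head q = head p) (hne : q ≠ p) :
    multPoly c q - multPoly c p ∈ restrictSupport R (headsBelow J (toColex p.1)) := by
  refine mem_restrictSupport_iff_coeff.mpr fun μ hμ r hr hrμ => ?_
  subst hrμ
  have hrp : head r ≠ head p := by
    intro heq
    rw [coeff_sub, heq, coeff_multPoly_head, ← h, coeff_multPoly_head, sub_self] at hμ
    exact hμ rfl
  by_cases hcoeff : coeff (head r) (multPoly c p) = 0
  · rw [coeff_sub, hcoeff, sub_zero] at hμ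
    exact (hr.toColex_lt_of_coeff_multPoly_ne_zero (h ▸ hrp) hμ).trans (hq.toColex_lt h hne)
  · exact hr.toColex_lt_of_coeff_multPoly_ne_zero hrp hcoeff

theorem multPoly_single_mem_span (hJ : IsStronglyStable J) {c : Var J → R}
    (hS : ∀ α α' : basisMon J, IsMin (lcmMult α α') → sPoly c α α' ∈ starSpan c Set.univ)
    {i : Fin (n + 1)} {α : basisMon J} (hstar : ¬ IsStar ((Finsupp.single i 1, α) : Mult J)) :
    multPoly c (Finsupp.single i 1, α) ∈ Submodule.span R
      (multPoly c '' {q | toColex q.1 < toColex (Finsupp.single i 1)}) := by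
  set p : Mult J := (Finsupp.single i 1, α)
  obtain ⟨q, hq, hqp⟩ := exists_isStar hJ (head_mem_monomialsIn p)
  have hne : q ≠ p := fun h => hstar (h ▸ hq)
  have hd := disjoint_single_fst hqp hne
  have hlcm : lcmMult q.2 p.2 = q := lcmMult_eq_of_disjoint hqp hd.symm
  have hlcm' : lcmMult p.2 q.2 = p := lcmMult_eq_of_disjoint hqp.symm hd
  have hsub : multPoly c q - multPoly c p ∈ starSpan c (headsBelow J (toColex p.1)) := by
    refine (reductionClosed_headsBelow c _).mem_starSpan hJ
      (hq.sub_mem_restrictSupport_headsBelow hqp hne) ?_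
    have hmem := hS q.2 p.2 (hlcm.symm ▸ hq.isMin)
    rwa [sPoly, hlcm, hlcm'] at hmem
  have hle : starSpan c (headsBelow J (toColex p.1)) ≤
      Submodule.span R (multPoly c '' {q | toColex q.1 < toColex p.1}) :=
    Submodule.span_mono (Set.image_mono fun r hr => hr.2 r hr.1 rfl)
  rw [← sub_sub_cancel (multPoly c q) (multPoly c p)]
  exact sub_mem (Submodule.subset_span ⟨q, hq.toColex_lt hqp hne, rfl⟩) (hle hsub)

theorem multPoly_mem_starSpan_of_sPoly (hJ : IsStronglyStable J) {c : Var J → R}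
    (hS : ∀ α α' : basisMon J, IsMin (lcmMult α α') → sPoly c α α' ∈ starSpan c Set.univ)
    (p : Mult J) : multPoly c p ∈ starSpan c Set.univ := by
  obtain ⟨δ, α⟩ := p
  induction hδ : toColex δ using WellFoundedLT.induction generalizing δ α with
  | ind d ih =>
    subst hδ
    by_cases hstar : IsStar ((δ, α) : Mult J)
    · exact hstar.multPoly_mem_starSpan trivial
    obtain ⟨i, j, hi, hj, hij⟩ : ∃ i j, δ i ≠ 0 ∧ (α : Mon n) j ≠ 0 ∧ j < i := by
      simpa only [IsStar, not_forall, not_le, exists_prop] using hstar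
    obtain ⟨ε, rfl⟩ : ∃ ε, δ = ε + Finsupp.single i 1 := le_iff_exists_add'.mp
      (Finsupp.single_le_iff.mpr (Nat.one_le_iff_ne_zero.mpr hi))
    have hsingle : ¬ IsStar ((Finsupp.single i 1, α) : Mult J) :=
      fun h => (h i j (by simp) hj).not_gt hij
    -- Multiplication by `X^ε` preserves the order of the cofactors.
    have hle : Submodule.span R (multPoly c '' {q | toColex q.1 < toColex (Finsupp.single i 1)}) ≤
        (starSpan c Set.univ).comap (LinearMap.mulLeft R (monomial ε 1)) := by
      rw [Submodule.span_le]
      rintro _ ⟨⟨ζ, β⟩, hζ, rfl⟩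
      rw [SetLike.mem_coe, Submodule.mem_comap, LinearMap.mulLeft_apply, ← multPoly_add]
      exact ih _ (add_lt_add_right hζ (toColex ε)) _ β rfl
    rw [multPoly_add]
    exact hle (multPoly_single_mem_span hJ hS hsingle)

theorem isMarkedBasis_of_sPoly_mem_starSpan (hJ : IsStronglyStable J) {c : Var J → R}
    (hS : ∀ α α' : basisMon J, IsMin (lcmMult α α') → sPoly c α α' ∈ starSpan c Set.univ) :
    IsMarkedBasis c :=
  (isMarkedBasis_iff hJ).mpr (multPoly_mem_starSpan_of_sPoly hJ hS)

theorem IsCompleteReduction.map_mem_starSpan_iff (hJ : IsStronglyStable J) {c : Var J → R}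
    {h h₀ : Poly n R} (hred : IsCompleteReduction c h h₀) (φ : R →+* S) :
    map φ h ∈ starSpan (φ ∘ c) Set.univ ↔ map φ h₀ = 0 := by
  have hsub := map_mem_starSpan φ
    ((reductionClosed_univ c).sub_mem_starSpan hJ hred.1 (Set.subset_univ _))
  have hN : map φ h₀ ∈ restrictSupport S (sousEscalier J) :=
    (Finset.coe_subset.mpr (support_map_subset φ h₀)).trans hred.mem_restrictSupport
  rw [map_sub] at hsub
  refine ⟨fun hh => Submodule.disjoint_def.mp (disjoint_starSpan (φ ∘ c)) _ ?_ hN, fun h0 => ?_⟩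
  · simpa only [sub_sub_cancel] using sub_mem hh hsub
  · rwa [h0, sub_zero] at hsub

section IdealR

variable {H : basisMon J → basisMon J → Poly n (CoeffRing J)} (φ : CoeffRing J →+* S)

theorem map_eq_zero_iff_coeff_mem_ker {A : Type*} [CommRing A] {φ : A →+* S} {h : Poly n A} :
    map φ h = 0 ↔ ∀ γ, coeff γ h ∈ RingHom.ker φ := by
  simp only [MvPolynomial.ext_iff, coeff_map, coeff_zero, RingHom.mem_ker]

theorem idealR_le_ker_iff : idealR H ≤ RingHom.ker φ ↔ ∀ α α', map φ (H α α') = 0 := by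
  simp only [map_eq_zero_iff_coeff_mem_ker, idealR, Ideal.span_le]
  exact ⟨fun h α α' γ => h ⟨α, α', γ, rfl⟩, fun h => by rintro _ ⟨α, α', γ, rfl⟩; exact h α α' γ⟩

theorem idealR'_le_ker_iff : idealR' H ≤ RingHom.ker φ ↔
    ∀ α α' : basisMon J, IsMin (lcmMult α α') → map φ (H α α') = 0 := by
  simp only [map_eq_zero_iff_coeff_mem_ker, idealR', Ideal.span_le]
  exact ⟨fun h α α' hmin γ => h ⟨α, α', γ, hmin, rfl⟩,
    fun h => by rintro _ ⟨α, α', γ, hmin, rfl⟩; exact h α α' hmin γ⟩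

variable (hJ : IsStronglyStable J)
  (hH : ∀ α α', IsCompleteReduction (generic J) (sPoly (generic J) α α') (H α α'))
include hJ hH

theorem idealR'_le_ker_iff_isMarkedBasis :
    idealR' H ≤ RingHom.ker φ ↔ IsMarkedBasis (φ ∘ generic J) := by
  simp only [idealR'_le_ker_iff, ← (hH _ _).map_mem_starSpan_iff hJ, map_sPoly]
  exact ⟨isMarkedBasis_of_sPoly_mem_starSpan hJ, fun h α α' _ => h.sPoly_mem_starSpan hJ α α'⟩

theorem idealR_le_ker_iff_isMarkedBasis :
    idealR H ≤ RingHom.ker φ ↔ IsMarkedBasis (φ ∘ generic J) := by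
  simp only [idealR_le_ker_iff, ← (hH _ _).map_mem_starSpan_iff hJ, map_sPoly]
  exact ⟨fun h => isMarkedBasis_of_sPoly_mem_starSpan hJ fun α α' _ => h α α',
    fun h => h.sPoly_mem_starSpan hJ⟩

end IdealR

end MarkedBasis

/-! ### Minors -/

section Minors

variable {n : ℕ} {k : Type u} [Field k] {J : Ideal (Poly n k)} {R S : Type u} [CommRing R]
  [CommRing S] {m : ℕ}

instance : Finite {δ : Mon n // δ.degree = m} := Finsupp.finite_of_degree_eq m

/-- The monomials of degree `m` in `J`; they index a basis of `J_m`, and the rows and columns of an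
invertible block of `A_m`. -/
abbrev DegreeMon (J : Ideal (Poly n k)) (m : ℕ) : Type :=
  {μ : monomialsIn J // (μ : Mon n).degree = m}

/-- A monomial of degree `m` in `J` as a column index of `A_m`. -/
def headColumn (η : DegreeMon J m) : {δ : Mon n // δ.degree = m} := ⟨η.1, η.2⟩

theorem headColumn_injective : Function.Injective (headColumn (J := J) (m := m)) :=
  fun _ _ h => Subtype.ext (Subtype.ext (Subtype.mk.inj h))

instance : Finite (DegreeMon J m) := Finite.of_injective _ headColumn_injective

instance : Fintype (DegreeMon J m) := Fintype.ofFinite _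

/-- The star product with head a given monomial of degree `m`, as a row index of `A_m`. -/
def starRow (hJ : IsStronglyStable J) (η : DegreeMon J m) : {p : Mult J // (head p).degree = m} :=
  ⟨starMult hJ η.1, (head_starMult hJ η.1).symm ▸ η.2⟩

/-- The matrix of the products `X^β f_α` with head of degree `m`: the specialization of `A_m` at
the coefficients `c`. -/
def multMatrix (c : Var J → R) (m : ℕ) :
    Matrix {p : Mult J // (head p).degree = m} {δ : Mon n // δ.degree = m} R :=
  Matrix.of fun p δ => coeff (δ : Mon n) (multPoly c p)

theorem IsMonomialIdeal.restrictScalars_eq (hJ : IsMonomialIdeal J) :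
    J.restrictScalars k = restrictSupport k (monomialsIn J) := by
  have hupper : IsUpperSet (monomialsIn J) := fun _ _ h hμ => monomialsIn_mono h hμ
  suffices J = restrictSupportIdeal (R := k) _ hupper by
    rw [← restrictScalars_restrictSupportIdeal (R := k) _ hupper, ← this]
  refine le_antisymm (hJ.trans_le (Ideal.span_le.mpr ?_)) fun f hf => ?_
  · rintro _ ⟨μ, hμ, rfl⟩
    exact (monomial_mem_restrictSupport k).mpr (.inl hμ)
  · rw [f.as_sum]
    refine J.sum_mem fun μ hμ => ?_
    rw [← mul_one (coeff μ f), ← C_mul_monomial]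
    exact J.mul_mem_left _ (hf hμ)

theorem finrank_degreePart (hJ : IsMonomialIdeal J) (m : ℕ) :
    Module.finrank k (degreePart J m) = Fintype.card (DegreeMon J m) := by
  have h : degreePart J m = restrictSupport k {η | η ∈ monomialsIn J ∧ η.degree = m} := by
    ext f
    rw [degreePart, hJ.restrictScalars_eq, Submodule.mem_inf, mem_homogeneousSubmodule,
      ← mem_restrictSupport_degree_iff]
    exact Set.subset_inter_iff.symm
  rw [h, Module.finrank_eq_nat_card_basis (basisRestrictSupport k _), ← Nat.card_eq_fintype_card]
  exact Nat.card_congr (Equiv.subtypeSubtypeEquivSubtypeInter _ _).symm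

variable (c : Var J → R)

theorem coeff_starMult_eq_zero (hJ : IsStronglyStable J) {η ζ : monomialsIn J} (hne : η ≠ ζ)
    (hle : toColex (starMult hJ η).1 ≤ toColex (starMult hJ ζ).1) :
    coeff (ζ : Mon n) (multPoly c (starMult hJ η)) = 0 := by
  by_contra hcoeff
  rw [← head_starMult hJ ζ] at hcoeff
  refine ((isStar_starMult hJ ζ).toColex_lt_of_coeff_multPoly_ne_zero (fun h => hne ?_)
    hcoeff).not_ge hle
  rw [head_starMult, head_starMult] at h
  exact Subtype.ext h.symm

-- Ordered by their cofactors, the star products form a unitriangular matrix.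
theorem det_multMatrix_submatrix_eq_one [DecidableEq (DegreeMon J m)] (hJ : IsStronglyStable J) :
    ((multMatrix c m).submatrix (starRow hJ) (headColumn (J := J))).det = 1 := by
  let M := (multMatrix c m).submatrix (starRow hJ) (headColumn (J := J))
  let b : DegreeMon J m → (Colex (Mon n))ᵒᵈ := fun η =>
    OrderDual.toDual (toColex (starMult hJ η.1).1)
  have hzero {η ζ : DegreeMon J m} (hne : η ≠ ζ) (hle : b ζ ≤ b η) : M η ζ = 0 :=
    coeff_starMult_eq_zero c hJ (fun h => hne (Subtype.ext h)) hle
  have hone (η : DegreeMon J m) : M η η = 1 := by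
    have := coeff_multPoly_head c (starMult hJ η.1)
    rwa [head_starMult] at this
  have htri : M.BlockTriangular b := fun η ζ hlt => hzero (fun h => hlt.ne (h ▸ rfl)) hlt.le
  change M.det = 1
  rw [htri.det]
  refine Finset.prod_eq_one fun a _ => ?_
  convert Matrix.det_one (n := {η // b η = a}) (R := R)
  ext η ζ
  rw [Matrix.toSquareBlock_def, Matrix.of_apply, Matrix.one_apply]
  split_ifs with h
  · rw [h, hone]
  · exact hzero (fun h' => h (Subtype.ext h')) (ζ.2.trans η.2.symm).le

theorem starSpan_degree_eq (hJ : IsStronglyStable J) : starSpan c {μ | μ.degree = m} =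
    Submodule.span R (Set.range fun η : DegreeMon J m => multPoly c (starMult hJ η.1)) := by
  rw [starSpan]
  congr 1
  refine Set.Subset.antisymm ?_ ?_
  · rintro _ ⟨p, ⟨hp, hdeg⟩, rfl⟩
    exact ⟨⟨⟨head p, head_mem_monomialsIn p⟩, hdeg⟩, congrArg _ (hp.starMult_eq hJ rfl)⟩
  · rintro _ ⟨η, rfl⟩
    exact ⟨_, ⟨isStar_starMult hJ η.1, (starRow hJ η).2⟩, rfl⟩

theorem multMatrix_mem_span_iff (hJ : IsStronglyStable J)
    (p : {p : Mult J // (head p).degree = m}) :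
    multMatrix c m p ∈ Submodule.span R (Set.range fun η => multMatrix c m (starRow hJ η)) ↔
      multPoly c p ∈ starSpan c {μ | μ.degree = m} := by
  let κ : Poly n R →ₗ[R] ({δ : Mon n // δ.degree = m} → R) := LinearMap.pi fun δ => lcoeff R δ.1
  have hinj : Set.InjOn κ (restrictSupport R {μ : Mon n | μ.degree = m}) := by
    intro f hf g hg h
    ext μ
    by_cases hμ : μ.degree = m
    · exact congrFun h ⟨μ, hμ⟩
    · rw [SetLike.mem_coe, mem_restrictSupport_iff_coeff] at hf hg
      rw [not_imp_comm.mp (hf μ) hμ, not_imp_comm.mp (hg μ) hμ]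
  have hrange : (Set.range fun η => multMatrix c m (starRow hJ η)) =
      κ '' Set.range fun η : DegreeMon J m => multPoly c (starMult hJ η.1) := by
    rw [← Set.range_comp]
    rfl
  rw [hrange, ← Submodule.map_span, ← starSpan_degree_eq]
  change κ (multPoly c p) ∈ _ ↔ _
  refine ⟨?_, Submodule.mem_map_of_mem⟩
  rintro ⟨w, hw, hwp⟩
  have hp : (multPoly c p.1).IsHomogeneous m := by
    have := isHomogeneous_multPoly c p.1
    rwa [p.2] at this
  rwa [← hinj ((reductionClosed_degree c m).starSpan_le hw)
    (mem_restrictSupport_degree_iff.mpr hp) hwp]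

theorem multPoly_mem_starSpan_degree_iff (hJ : IsStronglyStable J) (p : Mult J) :
    multPoly c p ∈ starSpan c {μ | μ.degree = (head p).degree} ↔
      multPoly c p ∈ starSpan c Set.univ :=
  ⟨fun h => starSpan_mono (Set.subset_univ _) h, (reductionClosed_degree c _).mem_starSpan hJ
    (mem_restrictSupport_degree_iff.mpr (isHomogeneous_multPoly c p))⟩

theorem isMarkedBasis_iff_minors_eq_zero (hJ : IsStronglyStable J) : IsMarkedBasis c ↔
    ∀ (m : ℕ)
      (F : Fin (Module.finrank k (degreePart J m) + 1) ↪ {p : Mult J // (head p).degree = m})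
      (G : Fin (Module.finrank k (degreePart J m) + 1) ↪ {δ : Mon n // δ.degree = m}),
      ((multMatrix c m).submatrix F G).det = 0 := by
  classical
  simp only [isMarkedBasis_iff hJ, ← multPoly_mem_starSpan_degree_iff c hJ]
  calc _ ↔ ∀ m (p : {p : Mult J // (head p).degree = m}),
          multPoly c p ∈ starSpan c {μ | μ.degree = m} :=
        ⟨by rintro h _ ⟨p, rfl⟩; exact h p, fun h p => h _ ⟨p, rfl⟩⟩
    _ ↔ _ := forall_congr' fun m => by
      have hunit := (det_multMatrix_submatrix_eq_one (m := m) c hJ).symm ▸ isUnit_one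
      rw [finrank_degreePart hJ.1]
      simp only [minors_eq_zero_iff_rows_mem_span hunit, multMatrix_mem_span_iff]

theorem map_coeffMatrix (φ : CoeffRing J →+* S) (m : ℕ) :
    (coeffMatrix J m).map φ = multMatrix (φ ∘ generic J) m := by
  ext p δ
  rw [Matrix.map_apply, coeffMatrix, Matrix.of_apply, multMatrix, Matrix.of_apply, ← map_multPoly,
    coeff_map]

theorem idealA_le_ker_iff_isMarkedBasis (hJ : IsStronglyStable J) (φ : CoeffRing J →+* S) :
    idealA J ≤ RingHom.ker φ ↔ IsMarkedBasis (φ ∘ generic J) := by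
  have hmap {τ : Type} [Fintype τ] [DecidableEq τ] {m : ℕ}
      (F : τ → {p : Mult J // (head p).degree = m}) (G : τ → {δ : Mon n // δ.degree = m}) :
      φ ((coeffMatrix J m).submatrix F G).det =
        ((multMatrix (φ ∘ generic J) m).submatrix F G).det := by
    rw [RingHom.map_det, RingHom.mapMatrix_apply, ← Matrix.submatrix_map, map_coeffMatrix]
  simp only [isMarkedBasis_iff_minors_eq_zero _ hJ, ← hmap]
  rw [idealA, Ideal.span_le]
  exact ⟨fun h m F G => h ⟨m, F, G, rfl⟩, fun h => by rintro _ ⟨m, F, G, rfl⟩; exact h m F G⟩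

end Minors

/-! ### Equality and homogeneity of the ideals -/

section Ideals

variable {n : ℕ} {k : Type u} [Field k] {J : Ideal (Poly n k)}

section Equality

variable {H : basisMon J → basisMon J → Poly n (CoeffRing J)} (hJ : IsStronglyStable J)
  (hH : ∀ α α', IsCompleteReduction (generic J) (sPoly (generic J) α α') (H α α'))
include hJ hH

theorem idealA_eq_idealR : idealA J = idealR H :=
  ideal_eq_of_forall_le_ker_iff fun _ _ φ => (idealA_le_ker_iff_isMarkedBasis hJ φ).trans
    (idealR_le_ker_iff_isMarkedBasis φ hJ hH).symm

theorem idealR_eq_idealR' : idealR H = idealR' H :=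
  ideal_eq_of_forall_le_ker_iff fun _ _ φ => (idealR_le_ker_iff_isMarkedBasis φ hJ hH).trans
    (idealR'_le_ker_iff_isMarkedBasis φ hJ hH).symm

end Equality

section Grading

attribute [local instance] MvPolynomial.weightedGradedAlgebra

theorem isWeightedHomogeneous_coeff_multPoly (p : Mult J) (μ : Mon n) :
    IsWeightedHomogeneous (lam J) (coeff μ (multPoly (generic J) p))
      ((fun l => (head p l : ℤ)) - fun l => (μ l : ℤ)) := by
  by_cases h0 : coeff μ (multPoly (generic J) p) = 0
  · rw [h0]
    exact isWeightedHomogeneous_zero _ _ _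
  obtain ⟨γ, rfl, hγ⟩ := exists_eq_add_of_coeff_multPoly_ne_zero h0
  rw [coeff_multPoly_add]
  rcases eq_or_mem_sousEscalier_of_coeff_marked_ne_zero hγ with rfl | hγ
  · rw [coeff_marked_self, head, sub_self]
    exact isWeightedHomogeneous_one k (lam J)
  · let v : Var J := ⟨(p.2, γ), p.2.2, hγ⟩
    have hweight : (fun l => (head p l : ℤ)) - (fun l => ((p.1 + γ) l : ℤ)) = lam J v := by
      ext l
      simp [head, lam, v]
    have hcoeff : coeff γ (marked J (generic J) p.2) = -X v := coeff_marked_var (generic J) v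
    rw [hweight, hcoeff]
    exact (isWeightedHomogeneous_X k (lam J) v).neg

theorem isLamHomogeneous_idealA (J : Ideal (Poly n k)) : IsLamHomogeneous (idealA J) := by
  refine Ideal.homogeneous_span _ _ ?_
  rintro _ ⟨m, F, G, rfl⟩
  exact ⟨_, isWeightedHomogeneous_det fun i j =>
    isWeightedHomogeneous_coeff_multPoly (F i).1 (G j).1⟩

end Grading

end Ideals

/-! ### The ideals of the family -/

section Family

attribute [local instance] MvPolynomial.gradedAlgebra

variable {n : ℕ} {k : Type u} [Field k] {J : Ideal (Poly n k)} {R : Type u} [CommRing R]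

theorem mem_family_iff {I : Ideal (Poly n k)} : I ∈ family J ↔
    I.IsHomogeneous (homogeneousSubmodule (Fin (n + 1)) k) ∧
      IsCompl (I.restrictScalars k) (restrictSupport k (sousEscalier J)) := by
  rw [isCompl_iff, ← linearIndependent_mk_monomial_iff_disjoint,
    ← span_mk_monomial_eq_top_iff_codisjoint]
  rfl

theorem marked_sub_marked_mem_restrictSupport (c c' : Var J → R) (α : basisMon J) :
    marked J c α - marked J c' α ∈ restrictSupport R (sousEscalier J) := by
  refine mem_restrictSupport_iff_coeff.mpr fun μ => not_imp_comm.mp fun hμ => ?_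
  rw [coeff_sub, coeff_marked, coeff_marked, dif_neg (fun h => hμ h.1), dif_neg (fun h => hμ h.1),
    sub_self]

theorem IsMarkedBasis.eq_of_span_marked_eq {c c' : Var J → R} (hc : IsMarkedBasis c)
    (h : Ideal.span (Set.range (marked J c)) = Ideal.span (Set.range (marked J c'))) : c = c' := by
  ext v
  let α : basisMon J := ⟨v.1.1, v.2.1⟩
  have hmem : marked J c α - marked J c' α ∈ Ideal.span (Set.range (marked J c)) :=
    sub_mem (Ideal.subset_span ⟨α, rfl⟩) (h.ge (Ideal.subset_span ⟨α, rfl⟩))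
  have hzero : marked J c α - marked J c' α = 0 := Submodule.disjoint_def.mp hc.disjoint _ hmem
    (marked_sub_marked_mem_restrictSupport c c' α)
  have hcoeff := congrArg (coeff v.1.2) hzero
  rw [coeff_sub, coeff_marked_var, coeff_marked_var, coeff_zero, sub_eq_zero] at hcoeff
  exact neg_injective hcoeff

theorem IsMarkedBasis.span_marked_mem_family {c : Var J → k} (hc : IsMarkedBasis c) :
    Ideal.span (Set.range (marked J c)) ∈ family J := by
  refine mem_family_iff.mpr ⟨Ideal.homogeneous_span _ _ ?_, hc⟩
  rintro _ ⟨α, rfl⟩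
  exact ⟨_, isHomogeneous_marked c α⟩

theorem homogeneousComponent_monomial_sub_eq_marked {z : basisMon J → Poly n R}
    (hz : ∀ α, z α ∈ restrictSupport R (sousEscalier J)) (α : basisMon J) :
    homogeneousComponent (α : Mon n).degree (monomial (α : Mon n) 1 - z α) =
      marked J (fun v => coeff v.1.2 (z ⟨v.1.1, v.2.1⟩)) α := by
  ext μ
  rw [coeff_marked, coeff_homogeneousComponent, coeff_sub, coeff_monomial]
  by_cases hdeg : μ.degree = (α : Mon n).degree
  · rw [if_pos hdeg]
    congr 1
    · simp only [eq_comm]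
    · split_ifs with hμ
      · rfl
      · exact not_imp_comm.mp (mem_restrictSupport_iff_coeff.mp (hz α) μ) fun h => hμ ⟨h, hdeg⟩
  · rw [if_neg hdeg, dif_neg (fun h => hdeg h.2), if_neg (fun h => hdeg (congrArg _ h)), sub_zero]

theorem exists_isMarkedBasis_of_mem_family (hJ : IsStronglyStable J) {I : Ideal (Poly n k)}
    (hI : I ∈ family J) :
    ∃ c : Var J → k, IsMarkedBasis c ∧ Ideal.span (Set.range (marked J c)) = I := by
  obtain ⟨hhom, hcompl⟩ := mem_family_iff.mp hI
  have hsplit (α : basisMon J) : ∃ z ∈ restrictSupport k (sousEscalier J),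
      monomial (α : Mon n) 1 - z ∈ I := by
    obtain ⟨y, hy, z, hz, hyz⟩ :=
      Submodule.mem_sup.mp (hcompl.sup_eq_top ▸ Submodule.mem_top (x := monomial (α : Mon n) 1))
    exact ⟨z, hz, by rwa [← hyz, add_sub_cancel_right]⟩
  choose z hz hzI using hsplit
  let c : Var J → k := fun v => coeff v.1.2 (z ⟨v.1.1, v.2.1⟩)
  have hle : Ideal.span (Set.range (marked J c)) ≤ I := by
    rw [Ideal.span_le]
    rintro _ ⟨α, rfl⟩
    rw [← homogeneousComponent_monomial_sub_eq_marked hz α]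
    exact homogeneousComponent_mem_of_mem hhom (hzI α) _
  have hstar : starSpan c Set.univ = I.restrictScalars k :=
    eq_of_le_of_codisjoint_of_disjoint ((starSpan_le_span_marked c _).trans hle)
      (isCompl_starSpan hJ c).codisjoint hcompl.disjoint
  have hspan : Ideal.span (Set.range (marked J c)) = I :=
    le_antisymm hle fun f hf => (starSpan_le_span_marked c _) (hstar.ge hf)
  exact ⟨c, by rwa [IsMarkedBasis, hspan], hspan⟩

theorem marked_zero (α : basisMon J) : marked J (0 : Var J → R) α = monomial (α : Mon n) 1 := by
  classical
  ext μ
  rw [coeff_marked, coeff_monomial]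
  refine (sub_eq_self.mpr (dite_eq_right_iff.mpr fun _ => rfl)).trans ?_
  simp only [eq_comm]

theorem multPoly_zero (p : Mult J) : multPoly (0 : Var J → R) p = monomial (head p) 1 := by
  rw [multPoly, marked_zero, monomial_mul, one_mul, head]

theorem isMarkedBasis_zero (hJ : IsStronglyStable J) : IsMarkedBasis (0 : Var J → R) := by
  refine (isMarkedBasis_iff hJ).mpr fun p => ?_
  obtain ⟨q, hq, hqp⟩ := exists_isStar hJ (head_mem_monomialsIn p)
  rw [multPoly_zero, ← hqp, ← multPoly_zero]
  exact hq.multPoly_mem_starSpan trivial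

theorem span_marked_zero (hJ : IsMonomialIdeal J) :
    Ideal.span (Set.range (marked J (0 : Var J → k))) = J := by
  refine le_antisymm (Ideal.span_le.mpr ?_) (hJ.trans_le (Ideal.span_le.mpr ?_))
  · rintro _ ⟨α, rfl⟩
    rw [marked_zero]
    exact α.2.1
  · rintro _ ⟨μ, hμ, rfl⟩
    obtain ⟨α, hα, hle⟩ := exists_basisMon_le hμ
    obtain ⟨δ, rfl⟩ := exists_add_of_le hle
    change monomial (α + δ) 1 ∈ _
    rw [add_comm α, ← mul_one (1 : k), ← monomial_mul, ← marked_zero ⟨α, hα⟩]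
    exact Ideal.mul_mem_left _ _ (Ideal.subset_span ⟨_, rfl⟩)

end Family

/-! ### Closed points -/

section Points

section AffineSpace

variable {σ k : Type*} [Field k] {I : Ideal (MvPolynomial σ k)}

/-- The point with coordinates `c` of the closed subscheme of affine space defined by `I`. -/
def evalPoint (c : {c : σ → k // I ≤ RingHom.ker (eval c)}) :
    PrimeSpectrum (MvPolynomial σ k ⧸ I) :=
  PrimeSpectrum.comap (Ideal.Quotient.lift I (eval c.1) c.2) ⊥

theorem comap_mk_evalPoint (c : {c : σ → k // I ≤ RingHom.ker (eval c)}) :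
    (evalPoint c).asIdeal.comap (Ideal.Quotient.mk I) = RingHom.ker (eval c.1) := rfl

theorem isClosed_singleton_evalPoint (c : {c : σ → k // I ≤ RingHom.ker (eval c)}) :
    IsClosed {evalPoint c} := by
  rw [PrimeSpectrum.isClosed_singleton_iff_isMaximal]
  refine RingHom.ker_isMaximal_of_surjective (Ideal.Quotient.lift I (eval c.1) c.2) fun a => ?_
  exact ⟨Ideal.Quotient.mk I (C a), eval_C a⟩

theorem ker_eval_injective :
    Function.Injective fun c : σ → k => RingHom.ker (eval c : MvPolynomial σ k →+* k) := by
  intro c c' h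
  ext i
  have hmem : X i - C (c i) ∈ RingHom.ker (eval c') := h.le (by simp)
  simpa [RingHom.mem_ker, sub_eq_zero, eq_comm] using hmem

theorem exists_evalPoint_eq [Finite σ] [IsAlgClosed k] {x : PrimeSpectrum (MvPolynomial σ k ⧸ I)}
    (hx : IsClosed {x}) : ∃ c, evalPoint c = x := by
  have hmax := (PrimeSpectrum.isClosed_singleton_iff_isMaximal x).mp hx
  have hcomap : (x.asIdeal.comap (Ideal.Quotient.mk I)).IsMaximal :=
    Ideal.comap_isMaximal_of_surjective _ Ideal.Quotient.mk_surjective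
  obtain ⟨c, hc⟩ := (isMaximal_iff_eq_vanishingIdeal_singleton (K := k)).mp hcomap
  have hker : x.asIdeal.comap (Ideal.Quotient.mk I) = RingHom.ker (eval c) := by
    rw [hc]
    ext f
    rw [mem_vanishingIdeal_singleton_iff, RingHom.mem_ker, aeval_eq_eval]
  have hle : I ≤ RingHom.ker (eval c) := by
    rw [← hker]
    exact Ideal.mk_ker.ge.trans (Ideal.ker_le_comap _)
  refine ⟨⟨c, hle⟩, PrimeSpectrum.ext ?_⟩
  exact Ideal.comap_injective_of_surjective _ Ideal.Quotient.mk_surjective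
    ((comap_mk_evalPoint _).trans hker.symm)

variable (I) in
/-- Nullstellensatz: over an algebraically closed field the closed points of a closed subscheme of
affine space are the points of `k^σ` at which its ideal vanishes. -/
def evalPointEquiv [Finite σ] [IsAlgClosed k] : {c : σ → k // I ≤ RingHom.ker (eval c)} ≃
    {x : PrimeSpectrum (MvPolynomial σ k ⧸ I) // IsClosed {x}} :=
  Equiv.ofBijective (fun c => ⟨evalPoint c, isClosed_singleton_evalPoint c⟩)
    ⟨fun _ _ h => Subtype.ext <| ker_eval_injective <|
      congrArg (fun x => x.1.asIdeal.comap (Ideal.Quotient.mk I)) h,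
    fun ⟨_, hx⟩ => (exists_evalPoint_eq hx).imp fun _ => Subtype.ext⟩

end AffineSpace

variable {n : ℕ} {k : Type u} [Field k] {J : Ideal (Poly n k)}

theorem idealA_le_coordIdeal_iff (hJ : IsStronglyStable J) (c : Var J → k) :
    idealA J ≤ coordIdeal c ↔ IsMarkedBasis c := by
  have hc : eval c ∘ generic J = c := funext fun v => eval_X v
  rw [coordIdeal, idealA_le_ker_iff_isMarkedBasis hJ, hc]

/-- The coefficient vectors at which `𝔄` vanishes correspond to the ideals of the family. -/
def coordsEquivFamily (hJ : IsStronglyStable J) :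
    {c : Var J → k // idealA J ≤ coordIdeal c} ≃ family J :=
  (Equiv.subtypeEquivRight (idealA_le_coordIdeal_iff hJ)).trans <|
    Equiv.ofBijective (fun c : {c : Var J → k // IsMarkedBasis c} =>
      ⟨Ideal.span (Set.range (marked J c.1)), c.2.span_marked_mem_family⟩)
    ⟨fun c _ h => Subtype.ext (c.2.eq_of_span_marked_eq (congrArg Subtype.val h)),
    fun ⟨_, hI⟩ => by
      obtain ⟨c, hc, h⟩ := exists_isMarkedBasis_of_mem_family hJ hI
      exact ⟨⟨c, hc⟩, Subtype.ext h⟩⟩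

variable [IsAlgClosed k]

/-- The bijection between the coefficient vectors at which `𝔄` vanishes and the closed points of
the stratum. -/
def coordsEquivClosedPoints (J : Ideal (Poly n k)) :
    {c : Var J → k // idealA J ≤ coordIdeal c} ≃ {x : BSt J // IsClosed ({x} : Set (BSt J))} :=
  evalPointEquiv (idealA J)

theorem pointIdeal_coordsEquivClosedPoints (c : {c : Var J → k // idealA J ≤ coordIdeal c}) :
    pointIdeal (coordsEquivClosedPoints J c).1 = coordIdeal c.1 := rfl

end Points

end Stratum

end

theorem theorem22 {k : Type*} [Field k] [IsAlgClosed k] (n : ℕ)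
    (J : Ideal (Stratum.Poly n k)) (hJ : Stratum.IsStronglyStable J) :
    -- closed points of the stratum correspond bijectively to the ideals of the family
    (∃ e : {x : Stratum.BSt J // IsClosed ({x} : Set (Stratum.BSt J))} ≃ Stratum.family J,
      (∀ x, ∃ c : Stratum.Var J → k,
        Stratum.pointIdeal x.1 = Stratum.coordIdeal c ∧
        (e x : Ideal (Stratum.Poly n k)) = Ideal.span (Set.range (Stratum.marked J c))) ∧
      ∃ o, Stratum.pointIdeal o.1 = Stratum.coordIdeal (0 : Stratum.Var J → k) ∧
        (e o : Ideal (Stratum.Poly n k)) = J) ∧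
    -- the ideal of the stratum is homogeneous for the grading over `ℤ^{n+1}`
    Stratum.IsLamHomogeneous (Stratum.idealA J) ∧
    -- complete reductions of the S-polynomials exist, and any choice of them gives the same ideal
    (∀ α α' : Stratum.basisMon J, ∃ h, Stratum.IsCompleteReduction (Stratum.generic J)
      (Stratum.sPoly (Stratum.generic J) α α') h) ∧
    (∀ H : Stratum.basisMon J → Stratum.basisMon J → Stratum.Poly n (Stratum.CoeffRing J),
      (∀ α α', Stratum.IsCompleteReduction (Stratum.generic J)
        (Stratum.sPoly (Stratum.generic J) α α') (H α α')) →
      Stratum.idealA J = Stratum.idealR H ∧ Stratum.idealR H = Stratum.idealR' H) := by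
  refine ⟨⟨(Stratum.coordsEquivClosedPoints J).symm.trans (Stratum.coordsEquivFamily hJ),
      fun x => ?_, ?_⟩,
    Stratum.isLamHomogeneous_idealA J, fun α α' => Stratum.exists_isCompleteReduction hJ _ _,
    fun H hH => ⟨Stratum.idealA_eq_idealR hJ hH, Stratum.idealR_eq_idealR' hJ hH⟩⟩
  · obtain ⟨c, rfl⟩ := (Stratum.coordsEquivClosedPoints J).surjective x
    refine ⟨c, Stratum.pointIdeal_coordsEquivClosedPoints c, ?_⟩
    rw [Equiv.trans_apply, Equiv.symm_apply_apply]
    rfl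
  · let o : {c : Stratum.Var J → k // Stratum.idealA J ≤ Stratum.coordIdeal c} :=
      ⟨0, (Stratum.idealA_le_coordIdeal_iff hJ 0).mpr (Stratum.isMarkedBasis_zero hJ)⟩
    refine ⟨Stratum.coordsEquivClosedPoints J o, Stratum.pointIdeal_coordsEquivClosedPoints o, ?_⟩
    rw [Equiv.trans_apply, Equiv.symm_apply_apply]
    exact Stratum.span_marked_zero hJ.1
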